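/- Let $\mathcal C$ be a triangulated category. For a $t$-structure $\mathcal D=(\mathcal D^{\le0},\mathcal D^{\ge0})$ on $\mathcal C$ write $\mathcal D^{\le n}=\mathcal D^{\le0}[-n]$, $\mathcal D^{\ge n}=\mathcal D^{\ge0}[-n]$, $\mathcal H_{\mathcal D}=\mathcal D^{\le0}\cap\mathcal D^{\ge0}$ for its heart, $\delta^{\le n},\delta^{\ge n}$ for its truncation functors and $H^k_{\mathcal D}(X)=\delta^{\ge0}\delta^{\le0}(X[k])\in\mathcal H_{\mathcal D}$ for its cohomology. The class $\mathcal D^{\le0}$ is called the aisle of $\mathcal D$; it determines $\mathcal D$. The $t$-structure $\mathcal D$ is non-degenerate if $\bigcap_n\mathcal D^{\le n}=0=\bigcap_n\mathcal D^{\ge n}$. Let $\mathcal D$ and $\mathcal T$ be non-degenerate $t$-structures on $\mathcal C$ and let $n\in\mathbb N$. Assume that - $(\mathcal D,\mathcal T)$ is left filterable: for every $i\in\mathbb Z$ the class $\mathcal D^{\le i}\cap\mathcal T^{\le0}$ is the aisle of a $t$-structure; - $(\mathcal D,\mathcal T)$ is of type $(n,0)$: $0$ is the largest integer $k$ with $\mathcal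 T^{\le k}\subseteq\mathcal D^{\le0}$, and $n$ is the smallest natural number $m$ with $\mathcal D^{\le -m}\subseteq\mathcal T^{\le0}$. For $i\in\mathbb Z$ let ${}_i\mathcal D$ (the $i$-th left basic $t$-structure) be the $t$-structure with aisle ${}_i\mathcal D^{\le0}=\mathcal D^{\le0}\cap\mathcal T^{\le n-i}$, let ${}_i\mathcal H$ be its heart, and let ${}_i\mathcal X={}_{i+1}\mathcal D^{\le0}\cap{}_i\mathcal H$ be the $i$-th left basic torsion class. Call $\mathcal T$ left $\mathcal D$-compatible if $\delta^{\le m}(\mathcal T^{\le0})\subseteq\mathcal T^{\le0}$ for every $m\in\mathbb Z$. Then $\mathcal T$ is left $\mathcal D$-compatible if and only if ${}_i\mathcal X\subseteq\mathcal H_{\mathcal D}$ for all $0\le i\le n-1$. If these equivalent conditions hold, then $${}_{n-1}\mathcal X\subseteq{}_{n-2}\mathcal X\subseteq\dots\subseteq{}_1\mathcal X\subseteq{}_0\mathcal X\subseteq\mathcal H_{\mathcal D},$$ and for every $0\le i\le n$ $${}_i\mathcal D^{\le0}=\{C\in\mathcal C\mid H^k_{\mathcal D}(C)\in{}_{i-1+k}\mathcal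 X\text{ for } -i+1\le k\le0,\ \text{and } H^k_{\mathcal D}(C)=0\text{ for } k>0\}.$$ -/

import Mathlib

open CategoryTheory CategoryTheory.Triangulated CategoryTheory.Limits
open CategoryTheory.Pretriangulated

universe v u

namespace TPair

section

variable {C : Type u} [Category.{v} C] [Preadditive C] [HasZeroObject C] [HasShift C ℤ]
  [∀ (n : ℤ), (shiftFunctor C n).Additive] [Pretriangulated C]

/-- A t-structure is non-degenerate if the intersection of all `≤ n` parts and the
intersection of all `≥ n` parts are zero. -/
def NonDegenerate (t : TStructure C) : Prop :=
  (∀ X : C, (∀ n : ℤ, t.le n X) → IsZero X) ∧ (∀ X : C, (∀ n : ℤ, t.ge n X) → IsZero X)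

/-- A class of objects is an aisle if it is the `≤ 0` part of a t-structure. -/
def IsAisle (P : ObjectProperty C) : Prop :=
  ∃ t : TStructure C, t.le 0 = P

/-- The pair `(D, T)` is left filterable if `D^{≤ i} ∩ T^{≤ 0}` is an aisle for all `i : ℤ`. -/
def LeftFilterable (D T : TStructure C) : Prop :=
  ∀ i : ℤ, IsAisle (D.le i ⊓ T.le 0)

/-- The pair `(D, T)` has type `(n, k)` (gap `n`, shift `k`): `k` is the maximal integer with
`T^{≤ k} ⊆ D^{≤ 0}` and `n` is the minimal natural number with `D^{≤ -n} ⊆ T^{≤ k}`. -/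
def HasType (D T : TStructure C) (n : ℕ) (k : ℤ) : Prop :=
  IsGreatest {j : ℤ | T.le j ≤ D.le 0} k ∧ IsLeast {m : ℕ | D.le (-(m : ℤ)) ≤ T.le k} n

/-- `T` is left `D`-compatible: `T^{≤ 0}` is stable under all truncations `δ^{≤ n}` of `D`. -/
def LeftCompatible (D T : TStructure C) : Prop :=
  ∀ (n : ℤ) (X : C), T.le 0 X → T.le 0 ((D.truncLE n).obj X)

/-- The cohomology functors of a t-structure,
`H^i(X) = δ^{≥ 0} δ^{≤ 0} (X[i])`, regarded as functors with values in `C`. -/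
noncomputable def cohomology (t : TStructure C) (i : ℤ) : C ⥤ C :=
  shiftFunctor C i ⋙ t.truncLE 0 ⋙ t.truncGE 0

/-- The objects `H^i(X)` lie in the heart. -/
theorem cohomology_mem_heart [IsTriangulated C] (t : TStructure C) (i : ℤ) (X : C) :
    t.heart ((cohomology t i).obj X) := by
  rw [TStructure.mem_heart_iff]
  dsimp only [cohomology, Functor.comp_obj]
  exact ⟨inferInstance, inferInstance⟩

/-- The re-indexed t-structure whose `≤ n` part is `t^{≤ n + a}`. -/
def reindex (t : TStructure C) (a : ℤ) : TStructure C where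
  le n := t.le (n + a)
  ge n := t.ge (n + a)
  le_shift n b n' h X hX := t.le_shift (n + a) b (n' + a) (by omega) X hX
  ge_shift n b n' h X hX := t.ge_shift (n + a) b (n' + a) (by omega) X hX
  zero' X Y f hX hY := by
    have : t.IsLE X (0 + a) := ⟨hX⟩
    have : t.IsGE Y (1 + a) := ⟨hY⟩
    exact t.zero f (0 + a) (1 + a) (by omega)
  le_zero_le := t.le_monotone (by omega)
  ge_one_le := t.ge_antitone (by omega)
  exists_triangle_zero_one A := t.exists_triangle A (0 + a) (1 + a) (by omega)

theorem LeftFilterable.exists_tStructure {D T : TStructure C} (h : LeftFilterable D T)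
    (j : ℤ) : ∃ t : TStructure C, t.le 0 = D.le 0 ⊓ T.le j := by
  obtain ⟨t, ht⟩ := h (-j)
  refine ⟨reindex t j, ?_⟩
  change t.le (0 + j) = _
  rw [← t.shift_le j 0 (0 + j) (by omega), ht, ← D.shift_le j (-j) 0 (by omega),
    ← T.shift_le j 0 j (by omega)]
  rfl

/-- A t-structure is determined by its aisle. -/
theorem eq_of_le_zero_eq {t t' : TStructure C} (h : t.le 0 = t'.le 0) : t = t' := by
  have hle : t.le = t'.le := by
    funext n
    rw [← t.shift_le n 0 n (by omega), ← t'.shift_le n 0 n (by omega), h]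
  have hge : t.ge = t'.ge := by
    funext n
    ext X
    rw [t.ge_iff_isGE, t'.ge_iff_isGE, t.isGE_iff_orthogonal (n - 1) n (by omega),
      t'.isGE_iff_orthogonal (n - 1) n (by omega)]
    simp only [← TStructure.le_iff_isLE, hle]
  cases t
  cases t'
  cases hle
  cases hge
  rfl

/-- For a left filterable pair `(D, T)` with `D^{≤ -m} ⊆ T^{≤ 0} ⊆ D^{≤ 0}`, the `i`-th left basic
t-structure: the (unique) t-structure whose aisle is `D^{≤ 0} ∩ T^{≤ m - i}`. -/
noncomputable def leftBasic {D T : TStructure C} (h : LeftFilterable D T) (m i : ℤ) :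
    TStructure C :=
  (h.exists_tStructure (m - i)).choose

theorem leftBasic_le_zero {D T : TStructure C} (h : LeftFilterable D T) (m i : ℤ) :
    (leftBasic h m i).le 0 = D.le 0 ⊓ T.le (m - i) :=
  (h.exists_tStructure (m - i)).choose_spec

/-- The `i`-th left basic torsion class: the intersection of the aisle of the `(i + 1)`-st left
basic t-structure with the heart of the `i`-th one. -/
noncomputable def leftTorsionClass {D T : TStructure C} (h : LeftFilterable D T) (m i : ℤ) :
    ObjectProperty C :=
  (leftBasic h m (i + 1)).le 0 ⊓ (leftBasic h m i).heart

end

end TPair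

namespace TPair

section

variable {C : Type u} [Category.{v} C] [Preadditive C] [HasZeroObject C] [HasShift C ℤ]
  [∀ (n : ℤ), (shiftFunctor C n).Additive] [Pretriangulated C]

/-! Let `t i` be the `i`-th left basic t-structure. If `T` is left `D`-compatible and `X` is in the
`i`-th torsion class, then `δ^{≤ -1} X` lies in `(t i)^{≤ -1}`, so its map to `X` vanishes and `X`
is in the heart of `D`. The class is thus the part of that heart in `T^{≤ n-i-1}`
(`leftTorsionClass_iff_heart`), whence the chain; dévissage along `D`-cohomology gives the
description of the aisles.

Conversely, `leftBasic_isLE_truncLE` climbs from the aisle `D^{≤ 0}` at `i = 0` to `T^{≤ 0}` at `i =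
n`: when the torsion class lies in the heart of `D`, the `t i`-truncation of an object of the next
aisle at `-1` is also its `D`-truncation. -/

/-- A triangle with first vertex `≤ a` and third vertex `> a` is a truncation triangle. -/
theorem nonempty_iso_truncLE (t : TStructure C) {S : Triangle C} (hS : S ∈ distTriang C) (a : ℤ)
    (h₁ : t.IsLE S.obj₁ a) (h₃ : t.IsGE S.obj₃ (a + 1)) :
    Nonempty (S.obj₁ ≅ (t.truncLE a).obj S.obj₂) := by
  obtain ⟨e, -⟩ := t.triangle_iso_exists hS (t.triangleLEGT_distinguished a S.obj₂)
    (Iso.refl _) a (a + 1) h₁ h₃ (inferInstanceAs (t.IsLE ((t.truncLE a).obj S.obj₂) a))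
    (inferInstanceAs (t.IsGE ((t.truncGT a).obj S.obj₂) (a + 1)))
  have e₁ := Triangle.π₁.mapIso e
  exact ⟨e₁⟩

/-- Truncations commute with shifts. -/
theorem nonempty_truncLE_shift_iso (t : TStructure C) (X : C) (a k b : ℤ) (h : k + a = b) :
    Nonempty (((t.truncLE b).obj X)⟦k⟧ ≅ (t.truncLE a).obj (X⟦k⟧)) :=
  nonempty_iso_truncLE t
    (Triangle.shift_distinguished _ (t.triangleLEGT_distinguished b X) k) a
    (t.isLE_shift ((t.truncLE b).obj X) b k a h)
    (t.isGE_shift ((t.truncGT b).obj X) (b + 1) k (a + 1) (by omega))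

theorem isLE₃ (t : TStructure C) {S : Triangle C} (hS : S ∈ distTriang C) (n : ℤ)
    (h₁ : t.IsLE S.obj₁ (n + 1)) (h₂ : t.IsLE S.obj₂ n) : t.IsLE S.obj₃ n :=
  t.isLE₂ _ (rot_of_distTriang _ hS) n h₂ (t.isLE_shift S.obj₁ (n + 1) 1 n (by omega))

theorem isLE_of_le {t t' : TStructure C} {a b : ℤ} (h : t.le a ≤ t'.le b) (c d : ℤ)
    (hcd : d - c = b - a) (X : C) (hX : t.IsLE X c) : t'.IsLE X d := by
  have h₁ := t.isLE_shift X c (c - a) a (by omega)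
  have h₂ : t'.IsLE (X⟦c - a⟧) b := ⟨h _ h₁.le⟩
  exact t'.isLE_of_shift X d (c - a) b (by omega)

theorem leftBasic_isLE_iff {D T : TStructure C} (h : LeftFilterable D T) (m i a : ℤ) (X : C) :
    (leftBasic h m i).IsLE X a ↔ D.IsLE X a ∧ T.IsLE X (m - i + a) := by
  rw [← (leftBasic h m i).isLE_shift_iff X a a 0, ← D.isLE_shift_iff X a a 0,
    ← T.isLE_shift_iff X (m - i + a) a (m - i), ← TStructure.le_iff_isLE, leftBasic_le_zero]
  simp

theorem leftTorsionClass_iff {D T : TStructure C} (h : LeftFilterable D T) (m i : ℤ) (X : C) :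
    leftTorsionClass h m i X ↔ (D.IsLE X 0 ∧ T.IsLE X (m - (i + 1))) ∧
      (leftBasic h m i).IsGE X 0 := by
  have h₁ := leftBasic_isLE_iff h m (i + 1) 0 X
  have h₂ := leftBasic_isLE_iff h m i 0 X
  rw [add_zero] at h₁ h₂
  change (leftBasic h m (i + 1)).le 0 X ∧ (leftBasic h m i).heart X ↔ _
  rw [TStructure.mem_heart_iff, TStructure.le_iff_isLE, h₁, h₂]
  constructor
  · tauto
  · rintro ⟨⟨hD, hT⟩, hX⟩
    exact ⟨⟨hD, hT⟩, ⟨hD, T.isLE_of_le X (m - (i + 1)) (m - i)⟩, hX⟩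

theorem LeftCompatible.isLE_truncLE {D T : TStructure C} (h : LeftCompatible D T) (a j : ℤ)
    (X : C) (hX : T.IsLE X j) : T.IsLE ((D.truncLE a).obj X) j := by
  have h₁ := T.isLE_shift X j j 0 (by omega)
  have h₂ : T.IsLE ((D.truncLE (a - j)).obj (X⟦j⟧)) 0 := ⟨h _ _ h₁.le⟩
  obtain ⟨e⟩ := nonempty_truncLE_shift_iso D X (a - j) j a (by omega)
  have := T.isLE_of_iso e.symm 0
  exact T.isLE_of_shift _ j j 0 (by omega)

theorem LeftCompatible.isLE_truncGE {D T : TStructure C} (h : LeftCompatible D T) (a j : ℤ)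
    (X : C) (hX : T.IsLE X j) : T.IsLE ((D.truncGE a).obj X) j := by
  refine isLE₃ T (D.triangleLEGE_distinguished (a - 1) a (by omega) X) j ?_ hX
  have := h.isLE_truncLE (a - 1) j X hX
  exact T.isLE_of_le ((D.truncLE (a - 1)).obj X) j (j + 1)

/-- Orthogonality for `t` kills `δ^{≤ -1} X ⟶ X`; by the universal property of `δ^{≤ -1}`, the
identity of `δ^{≤ -1} X` is then zero. -/
theorem isGE_zero_of_isLE_truncLE {D t : TStructure C} (X : C) (hX : t.IsGE X 0)
    (h : t.IsLE ((D.truncLE (-1)).obj X) (-1)) : D.IsGE X 0 := by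
  rw [D.isGE_iff_isZero_truncLE_obj (-1) 0 (by omega), IsZero.iff_id_eq_zero]
  apply D.to_truncLE_obj_ext
  rw [Category.id_comp, zero_comp]
  exact t.zero_of_isLE_of_isGE _ (-1) 0 (by omega) h hX

/-- If `T` is left `D`-compatible, the left basic torsion classes are contained in the heart. -/
theorem LeftCompatible.leftTorsionClass_le_heart {D T : TStructure C} (h : LeftCompatible D T)
    (hfil : LeftFilterable D T) (m i : ℤ) : leftTorsionClass hfil m i ≤ D.heart := by
  intro X hX
  rw [leftTorsionClass_iff] at hX
  obtain ⟨⟨hD, hT⟩, hX⟩ := hX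
  rw [TStructure.mem_heart_iff]
  refine ⟨hD, isGE_zero_of_isLE_truncLE X hX ?_⟩
  rw [leftBasic_isLE_iff]
  refine ⟨inferInstance, ?_⟩
  rw [show m - i + -1 = m - (i + 1) by omega]
  exact h.isLE_truncLE _ _ _ hT

theorem LeftCompatible.leftTorsionClass_iff_heart {D T : TStructure C} (h : LeftCompatible D T)
    (hfil : LeftFilterable D T) (m i : ℤ) (X : C) :
    leftTorsionClass hfil m i X ↔ D.heart X ∧ T.IsLE X (m - (i + 1)) := by
  refine ⟨fun hX ↦ ⟨h.leftTorsionClass_le_heart hfil m i X hX,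
    ((leftTorsionClass_iff hfil m i X).1 hX).1.2⟩, fun ⟨hX, hT⟩ ↦ ?_⟩
  rw [TStructure.mem_heart_iff] at hX
  rw [leftTorsionClass_iff]
  refine ⟨⟨hX.1, hT⟩, ?_⟩
  -- The basic aisle lies in `D^{≤ 0}`, so its coaisle contains `D^{≥ 0}`.
  rw [(leftBasic hfil m i).isGE_iff_orthogonal (-1) 0 (by omega)]
  intro Y f hY
  exact D.zero_of_isLE_of_isGE f (-1) 0 (by omega) ((leftBasic_isLE_iff hfil m i _ Y).1 hY).1 hX.2

/-- Up to a shift by `k`, `δ^{≤ k} X` is an extension of `H^k(X)` by `δ^{≤ k-1} X`, and aisles are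
closed under extensions. -/
theorem isLE_truncLE_of_isLE_cohomology [IsTriangulated C] (D t : TStructure C) (X : C)
    (k j : ℤ) (h₁ : t.IsLE ((D.truncLE (k - 1)).obj X) j)
    (h₂ : t.IsLE ((cohomology D k).obj X) (j - k)) : t.IsLE ((D.truncLE k).obj X) j := by
  obtain ⟨e⟩ := nonempty_truncLE_shift_iso D X 0 k k (by omega)
  obtain ⟨e'⟩ := nonempty_truncLE_shift_iso D X (-1) k (k - 1) (by omega)
  have := D.isIso_truncLE_map_truncLEι_app (-1) 0 (by omega) (X⟦k⟧)
  have := t.isLE_shift ((D.truncLE (k - 1)).obj X) j k (j - k)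
  have h₃ : t.IsLE ((D.truncLE (-1)).obj ((D.truncLE 0).obj (X⟦k⟧))) (j - k) :=
    t.isLE_of_iso (e' ≪≫ (asIso ((D.truncLE (-1)).map ((D.truncLEι 0).app (X⟦k⟧)))).symm) _
  have h₄ : t.IsLE ((D.truncLE 0).obj (X⟦k⟧)) (j - k) :=
    t.isLE₂ _ (D.triangleLEGE_distinguished (-1) 0 (by omega) ((D.truncLE 0).obj (X⟦k⟧)))
      (j - k) h₃ h₂
  have := t.isLE_of_iso e.symm (j - k)
  exact t.isLE_of_shift _ j k (j - k)

theorem isLE_truncLE_of_forall_isLE_cohomology [IsTriangulated C] (D t : TStructure C) (X : C)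
    (a b j : ℤ) (hab : a ≤ b) (h₁ : t.IsLE ((D.truncLE a).obj X) j)
    (h₂ : ∀ k, a < k → k ≤ b → t.IsLE ((cohomology D k).obj X) (j - k)) :
    t.IsLE ((D.truncLE b).obj X) j := by
  induction b, hab using Int.leInduction with
  | base => exact h₁
  | succ b hab ih =>
    refine isLE_truncLE_of_isLE_cohomology D t X (b + 1) j ?_ (h₂ _ (by omega) le_rfl)
    rw [add_sub_cancel_right]
    exact ih fun k hk hk' ↦ h₂ k hk (by omega)

/-- For a non-degenerate t-structure, an object is `≤ 0` as soon as its cohomology vanishes in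
positive degrees. -/
theorem NonDegenerate.isLE_zero [IsTriangulated C] {D : TStructure C} (hD : NonDegenerate D)
    (X : C) (h : ∀ k : ℤ, 0 < k → IsZero ((cohomology D k).obj X)) : D.IsLE X 0 := by
  rw [D.isLE_iff_isZero_truncGT_obj]
  refine hD.2 _ fun a ↦ ?_
  suffices ∀ b : ℤ, 0 ≤ b → D.IsGE ((D.truncGT 0).obj X) (b + 1) by
    have := this (max a 0) (by omega)
    exact (D.isGE_of_ge _ a (max a 0 + 1) (by omega)).ge
  intro b hb
  -- So `δ^{≤ b} X` is in `D^{≤ 0}`, and `δ^{≤ b} δ^{> 0} X ≅ δ^{> 0} δ^{≤ b} X` vanishes.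
  have := isLE_truncLE_of_forall_isLE_cohomology D D X 0 b 0 hb inferInstance
    fun k hk _ ↦ D.isLE_of_isZero (h k hk) _
  rw [D.isGE_iff_isZero_truncLE_obj b (b + 1) rfl]
  exact ((D.isLE_iff_isZero_truncGT_obj 0 _).1 this).of_iso
    ((D.truncGELEIsoLEGE (0 + 1) b).app X).symm

theorem isZero_cohomology [IsTriangulated C] (D : TStructure C) (X : C) (hX : D.IsLE X 0) (k : ℤ)
    (hk : 0 < k) : IsZero ((cohomology D k).obj X) := by
  have h₁ : D.IsLE (X⟦k⟧) (-k) := D.isLE_shift X 0 k (-k)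
  have h₂ : D.IsLE ((D.truncLE 0).obj (X⟦k⟧)) (-k) := inferInstance
  have h₃ : D.IsLE ((D.truncGE 0).obj ((D.truncLE 0).obj (X⟦k⟧))) (-k) := inferInstance
  exact D.isZero ((D.truncGE 0).obj ((D.truncLE 0).obj (X⟦k⟧))) (-k) 0

/-- If the left basic torsion classes lie in the heart of `D`, then the aisles of the left basic
t-structures are stable under the truncations of `D`. -/
theorem leftBasic_isLE_truncLE [IsTriangulated C] {D T : TStructure C}
    (hfil : LeftFilterable D T) (n : ℕ) (hn : D.le (-(n : ℤ)) ≤ T.le 0)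
    (hX : ∀ i : ℤ, 0 ≤ i → i < n → leftTorsionClass hfil n i ≤ D.heart)
    (i : ℤ) (hi : 0 ≤ i) (hin : i ≤ n) (a m : ℤ) (X : C) (h : (leftBasic hfil n i).IsLE X a) :
    (leftBasic hfil n i).IsLE ((D.truncLE m).obj X) a := by
  induction i, hi using Int.leInduction generalizing a m X with
  | base =>
    rw [leftBasic_isLE_iff] at h ⊢
    have := h.1
    have h₁ : D.IsLE ((D.truncLE m).obj X) a := inferInstance
    -- Since `D^{≤ 0} ⊆ T^{≤ n}`, the `0`-th aisle is `D^{≤ 0}` itself.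
    exact ⟨h₁, isLE_of_le hn _ _ (by omega) _ h₁⟩
  | succ i hi ih =>
    suffices ∀ (m : ℤ) (X : C), (leftBasic hfil n (i + 1)).IsLE X 0 →
        (leftBasic hfil n (i + 1)).IsLE ((D.truncLE m).obj X) 0 by
      obtain ⟨e⟩ := nonempty_truncLE_shift_iso D X (m - a) a m (by omega)
      have := this (m - a) (X⟦a⟧) (TStructure.isLE_shift _ X a a 0)
      have := (leftBasic hfil n (i + 1)).isLE_of_iso e.symm 0
      exact (leftBasic hfil n (i + 1)).isLE_of_shift _ a a 0
    clear h X m a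
    intro m X h
    by_cases hm : 0 ≤ m
    · have := ((leftBasic_isLE_iff hfil n _ _ X).1 h).1
      have := D.isLE_of_le X 0 m
      exact TStructure.isLE_of_iso _
        (show X ≅ (D.truncLE m).obj X from (asIso ((D.truncLEι m).app X)).symm) 0
    let t := leftBasic hfil n i
    let t' := leftBasic hfil n (i + 1)
    have hle (Y : C) (hY : t.IsLE Y (-1)) : t'.IsLE Y 0 := by
      rw [leftBasic_isLE_iff] at hY ⊢
      have := hY.1
      refine ⟨D.isLE_of_le Y (-1) 0, ?_⟩
      rw [show (n : ℤ) - (i + 1) + 0 = n - i + -1 by omega]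
      exact hY.2
    have hY : t.IsLE ((t.truncLE (-1)).obj X) (-1) := inferInstance
    have hY' := hle _ hY
    have hH : t'.IsLE ((t.truncGE 0).obj X) 0 :=
      isLE₃ t' (t.triangleLEGE_distinguished (-1) 0 (by omega) X) 0
        (t'.isLE_of_le ((t.truncLE (-1)).obj X) 0 (0 + 1)) h
    have hH' : leftTorsionClass hfil n i ((t.truncGE 0).obj X) := by
      rw [leftTorsionClass_iff]
      have := (leftBasic_isLE_iff hfil n (i + 1) 0 _).1 hH
      rw [add_zero] at this
      exact ⟨this, inferInstanceAs (t.IsGE ((t.truncGE 0).obj X) 0)⟩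
    have hH'' := hX i hi (by omega) _ hH'
    rw [TStructure.mem_heart_iff] at hH''
    -- As the third vertex is in `D^{≥ 0}`, this `t`-triangle is also the `D`-truncation triangle.
    -- Hence `δ^{≤ m} X` can be computed from a vertex in `t^{≤ -1}`, where the induction hypothesis
    -- applies.
    obtain ⟨e⟩ := nonempty_iso_truncLE D (t.triangleLEGE_distinguished (-1) 0 (by omega) X) (-1)
      ((leftBasic_isLE_iff hfil n i _ _).1 hY).1 hH''.2
    have h₁ : t.IsLE ((D.truncLE (-1)).obj X) (-1) :=
      t.isLE_of_iso (show (t.truncLE (-1)).obj X ≅ (D.truncLE (-1)).obj X from e) (-1)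
    have := D.isIso_truncLE_map_truncLEι_app m (-1) (by omega) X
    have h₂ := ih (by omega) (-1) m _ h₁
    exact hle _ (t.isLE_of_iso (asIso ((D.truncLE m).map ((D.truncLEι (-1)).app X))) (-1))

theorem leftCompatible_of_leftTorsionClass_le_heart [IsTriangulated C] {D T : TStructure C}
    (hfil : LeftFilterable D T) (n : ℕ) (hn : D.le (-(n : ℤ)) ≤ T.le 0) (hT : T.le 0 ≤ D.le 0)
    (hX : ∀ i : ℤ, 0 ≤ i → i < n → leftTorsionClass hfil n i ≤ D.heart) :
    LeftCompatible D T := by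
  intro m X h
  have h₁ : (leftBasic hfil n n).IsLE X 0 := by
    rw [leftBasic_isLE_iff, sub_self, add_zero]
    exact ⟨⟨hT _ h⟩, ⟨h⟩⟩
  have h₂ := leftBasic_isLE_truncLE hfil n hn hX n (by omega) le_rfl 0 m X h₁
  rw [leftBasic_isLE_iff, sub_self, add_zero] at h₂
  exact h₂.2.le

/-- Under left compatibility, the aisles of the left basic t-structures are described by the
cohomology of `D`. -/
theorem LeftCompatible.leftBasic_isLE_zero_iff [IsTriangulated C] {D T : TStructure C}
    (h : LeftCompatible D T) (hD : NonDegenerate D) (hfil : LeftFilterable D T) (n : ℕ)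
    (hn : D.le (-(n : ℤ)) ≤ T.le 0) (i : ℤ) (hi : 0 ≤ i) (X : C) :
    (leftBasic hfil n i).IsLE X 0 ↔
      (∀ k : ℤ, -i + 1 ≤ k → k ≤ 0 →
        leftTorsionClass hfil n (i - 1 + k) ((cohomology D k).obj X)) ∧
      (∀ k : ℤ, 0 < k → IsZero ((cohomology D k).obj X)) := by
  rw [leftBasic_isLE_iff, add_zero]
  constructor
  · rintro ⟨h₁, h₂⟩
    refine ⟨fun k _ _ ↦ ?_, isZero_cohomology D X h₁⟩
    rw [h.leftTorsionClass_iff_heart]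
    refine ⟨cohomology_mem_heart D k X, ?_⟩
    exact h.isLE_truncGE 0 _ _ (h.isLE_truncLE 0 _ _
      (T.isLE_shift X (n - i) k (n - (i - 1 + k + 1)) (by omega)))
  · rintro ⟨h₁, h₂⟩
    have h₃ := hD.isLE_zero X h₂
    refine ⟨h₃, ?_⟩
    -- The dévissage starts at `-i` because `D^{≤ -i} ⊆ T^{≤ n-i}` holds without any condition on
    -- cohomology.
    have h₄ := isLE_truncLE_of_forall_isLE_cohomology D T X (-i) 0 (n - i) (by omega)
      (isLE_of_le hn (-i) (n - i) (by omega) _ inferInstance) fun k hk hk' ↦ by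
        have := ((h.leftTorsionClass_iff_heart hfil n _ _).1 (h₁ k (by omega) hk')).2
        rwa [show (n : ℤ) - (i - 1 + k + 1) = n - i - k by omega] at this
    exact T.isLE_of_iso (asIso ((D.truncLEι 0).app X)) _

end

end TPair

theorem mainTheorem5 {C : Type u} [Category.{v} C] [Preadditive C] [HasZeroObject C]
    [HasShift C ℤ] [∀ (n : ℤ), (shiftFunctor C n).Additive] [Pretriangulated C]
    [IsTriangulated C] (D T : TStructure C)
    (hD : TPair.NonDegenerate D) (hT : TPair.NonDegenerate T)
    (n : ℕ) (hfil : TPair.LeftFilterable D T) (htype : TPair.HasType D T n 0) :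
    (TPair.LeftCompatible D T ↔
      ∀ i : ℤ, 0 ≤ i → i < n → TPair.leftTorsionClass hfil n i ≤ D.heart) ∧
    (TPair.LeftCompatible D T →
      (∀ i : ℤ, 0 ≤ i → i + 1 < n →
        TPair.leftTorsionClass hfil n (i + 1) ≤ TPair.leftTorsionClass hfil n i) ∧
      (0 < n → TPair.leftTorsionClass hfil n 0 ≤ D.heart) ∧
      (∀ i : ℤ, 0 ≤ i → i ≤ n → ∀ X : C,
        (TPair.leftBasic hfil n i).le 0 X ↔
          (∀ k : ℤ, -i + 1 ≤ k → k ≤ 0 →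
            TPair.leftTorsionClass hfil n (i - 1 + k) ((TPair.cohomology D k).obj X)) ∧
          (∀ k : ℤ, 0 < k → IsZero ((TPair.cohomology D k).obj X)))) := by
  have hn : D.le (-(n : ℤ)) ≤ T.le 0 := htype.2.1
  refine ⟨⟨fun h i _ _ ↦ h.leftTorsionClass_le_heart hfil n i,
    TPair.leftCompatible_of_leftTorsionClass_le_heart hfil n hn htype.1.1⟩,
    fun h ↦ ⟨fun i _ _ X hX ↦ ?_, fun _ ↦ h.leftTorsionClass_le_heart hfil n 0,
      fun i hi _ X ↦ ?_⟩⟩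
  · rw [h.leftTorsionClass_iff_heart] at hX ⊢
    have := hX.2
    exact ⟨hX.1, T.isLE_of_le X (n - (i + 1 + 1)) (n - (i + 1))⟩
  · rw [TStructure.le_iff_isLE]
    exact h.leftBasic_isLE_zero_iff hD hfil n hn i hi X
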